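/- Let $N\ge 1$, $0<s<1$, $p\ge 2$, $p'=p/(p-1)$, $I=[t_0,t_1]$ with $t_0<t_1$, and let $\Omega\Subset\Omega'\subset\mathbb{R}^N$ be bounded open sets. Let $J_p(a)=|a|^{p-2}a$. For an open set $A$, $W^{s,p}(A)$ is the space of $v\in L^p(A)$ with finite norm $$\|v\|_{W^{s,p}(A)}=\|v\|_{L^p(A)}+\Big(\iint_{A\times A}\frac{|v(x)-v(y)|^p}{|x-y|^{N+sp}}\,dx\,dy\Big)^{1/p},$$ and $L^{p-1}_{sp}(\mathbb{R}^N)$ is the space of measurable $v$ with finite norm $\big(\int_{\mathbb{R}^N}\frac{|v(x)|^{p-1}}{1+|x|^{N+sp}}\,dx\big)^{1/(p-1)}$. For a function $\psi$ on $\mathbb{R}^N$ put $$X_\psi^{s,p}(\Omega,\Omega')=\{v\in W^{s,p}(\Omega')\cap L^{p-1}_{sp}(\mathbb{R}^N): v=\psi \text{ a.e. on } \mathbb{R}^N\setminus\Omega\},$$ where $X_0^{s,p}(\Omega,\Omega')$ carries the norm of $W^{s,p}(\Omega')$. Suppose that $$g\in L^p(I;W^{s,p}(\Omega'))\cap L^{p-1}(I;L^{p-1}_{sp}(\mathbb{R}^N)),\qquad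 \partial_t g\in L^{p'}(I;(X_0^{s,p}(\Omega,\Omega'))^*),$$ that $\lim_{t\to t_0}\|g(\cdot,t)-g_0\|_{L^2(\Omega)}=0$ for some $g_0\in L^2(\Omega)$, and that $u_0\in L^2(\Omega)$. Let $u$ be a weak solution of $$\partial_t u+(-\Delta_p)^s u=0\ \text{ in }\Omega\times I,\qquad u=g\ \text{ on }(\mathbb{R}^N\setminus\Omega)\times I,\qquad u(\cdot,t_0)=u_0\ \text{ on }\Omega,$$ that is: * $u\in L^p(I;W^{s,p}(\Omega'))\cap L^{p-1}(I;L^{p-1}_{sp}(\mathbb{R}^N))\cap C(I;L^2(\Omega))$; * $u(\cdot,t)\in X^{s,p}_{g(\cdot,t)}(\Omega,\Omega')$ for almost every $t\in I$; * $\lim_{t\to t_0}\|u(\cdot,t)-u_0\|_{L^2(\Omega)}=0$; * for every $J=[T_0,T_1]\subset I$ and every $\phi\in L^p(J;X_0^{s,p}(\Omega,\Omega'))\cap C^1(J;L^2(\Omega))$, $$-\int_J\int_\Omega u\,\partial_t\phi\,dx\,dt+\int_J\iint_{\mathbb{R}^N\times\mathbb{R}^N}\frac{J_p(u(x,t)-u(y,t))\,(\phi(x,t)-\phi(y,t))}{|x-y|^{N+sp}}\,dx\,dy\,dt=\int_\Omega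 u(x,T_0)\,\phi(x,T_0)\,dx-\int_\Omega u(x,T_1)\,\phi(x,T_1)\,dx.$$ Suppose moreover that $g\in L^\infty(\mathbb{R}^N\times I)$ and $u_0\in L^\infty(\Omega)$. Then $$\|u\|_{L^\infty(\mathbb{R}^N\times I)}\le\|u_0\|_{L^\infty(\Omega)}+\|g\|_{L^\infty(\mathbb{R}^N\times I)}.$$ -/

import Mathlib

open MeasureTheory Set Filter Topology
open scoped ENNReal

namespace FracPLap

noncomputable section

/-- The space `ℝ^N` with its Euclidean norm and Lebesgue measure. -/
abbrev Sp (N : ℕ) : Type := EuclideanSpace ℝ (Fin N)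

/-- The monotone function `J_p(a) = |a|^(p-2) a`. -/
def Jp (p a : ℝ) : ℝ := |a| ^ (p - 2) * a

/-- Lebesgue measure on `I × A`, time coordinate first. -/
abbrev timeSpace {N : ℕ} (I : Set ℝ) (A : Set (Sp N)) : Measure (ℝ × Sp N) :=
  ((volume : Measure ℝ).restrict I).prod ((volume : Measure (Sp N)).restrict A)

/-- The `p`-th power of the Sobolev-Slobodeckii seminorm of `ψ` on `A`,
`∬_{A × A} |ψ(x) - ψ(y)|^p / |x - y|^(N + s p) dx dy`. -/
def gagliardo {N : ℕ} (s p : ℝ) (A : Set (Sp N)) (ψ : Sp N → ℝ) : ℝ≥0∞ :=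
  ∫⁻ z, ENNReal.ofReal (|ψ z.1 - ψ z.2| ^ p / ‖z.1 - z.2‖ ^ ((N : ℝ) + s * p))
    ∂(((volume : Measure (Sp N)).restrict A).prod ((volume : Measure (Sp N)).restrict A))

/-- The norm of `W^{s,p}(A)`: the `L^p(A)` norm plus the Sobolev-Slobodeckii seminorm
(`∞` if one of them is not finite). -/
def sobolevNorm {N : ℕ} (s p : ℝ) (A : Set (Sp N)) (ψ : Sp N → ℝ) : ℝ≥0∞ :=
  eLpNorm ψ (ENNReal.ofReal p) (volume.restrict A) + gagliardo s p A ψ ^ (1 / p)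

/-- Membership in `W^{s,p}(A)`. -/
def MemSobolev {N : ℕ} (s p : ℝ) (A : Set (Sp N)) (ψ : Sp N → ℝ) : Prop :=
  AEStronglyMeasurable ψ (volume.restrict A) ∧ sobolevNorm s p A ψ < ∞

/-- The norm of the tail space `L^q_α(ℝ^N)`,
`(∫ |ψ|^q / (1 + |x|^(N + α)) dx)^(1/q)`. -/
def tailNorm {N : ℕ} (q α : ℝ) (ψ : Sp N → ℝ) : ℝ≥0∞ :=
  (∫⁻ x, ENNReal.ofReal (|ψ x| ^ q / (1 + ‖x‖ ^ ((N : ℝ) + α)))) ^ (1 / q)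

/-- Membership in the tail space `L^q_α(ℝ^N)` (local `q`-integrability follows, since the weight
is bounded below on bounded sets). -/
def MemTail {N : ℕ} (q α : ℝ) (ψ : Sp N → ℝ) : Prop :=
  AEStronglyMeasurable ψ volume ∧ tailNorm q α ψ < ∞

/-- Membership in
`X_ψ^{s,p}(Ω, Ω') = {v ∈ W^{s,p}(Ω') ∩ L^{p-1}_{sp}(ℝ^N) : v = ψ on ℝ^N ∖ Ω}`. -/
structure MemX {N : ℕ} (s p : ℝ) (Ω Ω' : Set (Sp N)) (ψ v : Sp N → ℝ) : Prop where
  sobolev : MemSobolev s p Ω' v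
  tail : MemTail (p - 1) (s * p) v
  eq_outside : v =ᵐ[volume.restrict Ωᶜ] ψ

/-- `v ∈ L^p(I; W^{s,p}(A))`, where `v t x` stands for `v(x,t)`. -/
structure MemLpSobolev {N : ℕ} (s p : ℝ) (I : Set ℝ) (A : Set (Sp N)) (v : ℝ → Sp N → ℝ) :
    Prop where
  meas : AEStronglyMeasurable (Function.uncurry v) (timeSpace I A)
  mem : ∀ᵐ t ∂(volume.restrict I), MemSobolev s p A (v t)
  finite : ∫⁻ t in I, sobolevNorm s p A (v t) ^ p < ∞

/-- `v ∈ L^q(I; L^q_α(ℝ^N))`. -/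
structure MemLpTail {N : ℕ} (q α : ℝ) (I : Set ℝ) (v : ℝ → Sp N → ℝ) : Prop where
  meas : AEStronglyMeasurable (Function.uncurry v) (timeSpace I univ)
  mem : ∀ᵐ t ∂(volume.restrict I), MemTail q α (v t)
  finite : ∫⁻ t in I, tailNorm q α (v t) ^ q < ∞

/-- The curve `V` in the Hilbert space `L^2(Ω)` is `t ↦ v(·,t)|_Ω`, `t ∈ J`. -/
def IsL2Curve {N : ℕ} (Ω : Set (Sp N)) (J : Set ℝ) (v : ℝ → Sp N → ℝ)
    (V : ℝ → Lp ℝ 2 ((volume : Measure (Sp N)).restrict Ω)) : Prop :=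
  ∀ t ∈ J, V t =ᵐ[volume.restrict Ω] v t

/-- `v ∈ C(J; L^2(Ω))`. -/
def MemCL2 {N : ℕ} (Ω : Set (Sp N)) (J : Set ℝ) (v : ℝ → Sp N → ℝ) : Prop :=
  ∃ V : ℝ → Lp ℝ 2 ((volume : Measure (Sp N)).restrict Ω),
    IsL2Curve Ω J v V ∧ ContinuousOn V J

/-- `φ ∈ L^p(J; X_0^{s,p}(Ω, Ω')) ∩ C^1(J; L^2(Ω))`, the curve `t ↦ φ(·,t)` in `L^2(Ω)`
being `Φ`. -/
structure IsTest {N : ℕ} (s p : ℝ) (Ω Ω' : Set (Sp N)) (J : Set ℝ) (φ : ℝ → Sp N → ℝ)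
    (Φ : ℝ → Lp ℝ 2 ((volume : Measure (Sp N)).restrict Ω)) : Prop where
  meas : AEStronglyMeasurable (Function.uncurry φ) (timeSpace J univ)
  lpSobolev : MemLpSobolev s p J Ω' φ
  memX : ∀ᵐ t ∂(volume.restrict J), MemX s p Ω Ω' 0 (φ t)
  curve : IsL2Curve Ω J φ Φ
  contDiff : ContDiffOn ℝ 1 Φ J

/-- `∬_{ℝ^N × ℝ^N} J_p(v(x) - v(y)) (w(x) - w(y)) / |x - y|^(N + s p) dx dy`. -/
def nonlocalForm {N : ℕ} (s p : ℝ) (v w : Sp N → ℝ) : ℝ :=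
  ∫ z : Sp N × Sp N,
    Jp p (v z.1 - v z.2) * (w z.1 - w z.2) / ‖z.1 - z.2‖ ^ ((N : ℝ) + s * p)

/-- Weak solutions on `I = [t₀, t₁]` of the initial boundary value problem
`∂_t u + (-Δ_p)^s u = 0` in `Ω × I`, `u = g` on `(ℝ^N ∖ Ω) × I`, `u(·,t₀) = u₀` on `Ω`.
In the weak formulation `∂_t φ` is the derivative of the curve `Φ` in `L^2(Ω)`. -/
structure IsWeakSolution {N : ℕ} (s p : ℝ) (Ω Ω' : Set (Sp N)) (t₀ t₁ : ℝ)
    (g : ℝ → Sp N → ℝ) (u₀ : Sp N → ℝ) (u : ℝ → Sp N → ℝ) : Prop where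
  lpSobolev : MemLpSobolev s p (Icc t₀ t₁) Ω' u
  lpTail : MemLpTail (p - 1) (s * p) (Icc t₀ t₁) u
  contL2 : MemCL2 Ω (Icc t₀ t₁) u
  boundary : ∀ᵐ t ∂(volume.restrict (Icc t₀ t₁)), MemX s p Ω Ω' (g t) (u t)
  initial : Tendsto (fun t => eLpNorm (u t - u₀) 2 (volume.restrict Ω)) (𝓝[>] t₀) (𝓝 0)
  weak : ∀ T₀ T₁ : ℝ, T₀ < T₁ → Icc T₀ T₁ ⊆ Icc t₀ t₁ →
    ∀ (φ : ℝ → Sp N → ℝ) (Φ : ℝ → Lp ℝ 2 ((volume : Measure (Sp N)).restrict Ω)),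
      IsTest s p Ω Ω' (Icc T₀ T₁) φ Φ →
        -(∫ t in Icc T₀ T₁, ∫ x in Ω, u t x * (derivWithin Φ (Icc T₀ T₁) t) x)
            + ∫ t in Icc T₀ T₁, nonlocalForm s p (u t) (φ t)
          = (∫ x in Ω, u T₀ x * φ T₀ x) - ∫ x in Ω, u T₁ x * φ T₁ x

/-- `∂_t g ∈ L^{p'}(I; (X_0^{s,p}(Ω, Ω'))^*)` with `I = [t₀, t₁]` and `p' = p / (p - 1)`: there is
a family `F t` of linear functionals on `X_0^{s,p}(Ω, Ω')`, with the norm of `W^{s,p}(Ω')`, whose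
dual norms are controlled by some `k ∈ L^{p'}(I)`, and which is the derivative of `t ↦ g(·,t)`
in the sense of distributions on `(t₀, t₁)`. -/
def HasTimeDerivInDual {N : ℕ} (s p : ℝ) (Ω Ω' : Set (Sp N)) (t₀ t₁ : ℝ)
    (g : ℝ → Sp N → ℝ) : Prop :=
  ∃ (F : ℝ → (Sp N → ℝ) → ℝ) (k : ℝ → ℝ),
    MemLp k (ENNReal.ofReal (p / (p - 1))) (volume.restrict (Icc t₀ t₁)) ∧
    (∀ᵐ t ∂(volume.restrict (Icc t₀ t₁)),
      (∀ v w : Sp N → ℝ, MemX s p Ω Ω' 0 v → MemX s p Ω Ω' 0 w → ∀ a b : ℝ,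
        F t (a • v + b • w) = a * F t v + b * F t w) ∧
      ∀ v : Sp N → ℝ, MemX s p Ω Ω' 0 v → |F t v| ≤ k t * (sobolevNorm s p Ω' v).toReal) ∧
    ∀ v : Sp N → ℝ, MemX s p Ω Ω' 0 v →
      AEStronglyMeasurable (fun t => F t v) (volume.restrict (Icc t₀ t₁)) ∧
      ∀ ψ : ℝ → ℝ, ContDiff ℝ (⊤ : ℕ∞) ψ → HasCompactSupport ψ → tsupport ψ ⊆ Ioo t₀ t₁ →
        ∫ t in Icc t₀ t₁, F t v * ψ t
          = -∫ t in Icc t₀ t₁, (∫ x in Ω, g t x * v x) * deriv ψ t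

end

end FracPLap

open FracPLap

/-! Let `M` be the sum of the two bounds and e(t) = ½‖(u(t) - M)₊‖² in L²(Ω). Formally, testing the
equation with (u - M)₊ gives e' ≤ 0, since J_p(u(x) - u(y)) and the difference of (u - M)₊ between x
and y have the same sign. As e(t₀) = 0, this forces u ≤ M, and -u is treated alike.

The curve u need not be differentiable in L²(Ω), so (u - M)₊ may fail to be an admissible test
function. Instead it is frozen: for fixed t, w = (u(t) - M)₊ is used on [t - h, t] as a test
function independent of time. Convexity bounds e(t) - e(t - h) by the integral of (u(t) - u(t - h))
w, which by the equation is minus the integral over τ in [t - h, t] of the nonlocal form of u(τ)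
against w (`IsTestedByConstants.energy_le`).

At τ = t the form would be nonnegative. Replacing the flux at time t by that at time τ costs, after
integration in t, at most ε h for small h, by continuity of translations in L^{p'}
(`exists_lintegral_window_neg_mul_le`). Integrating the increments of e up to T leaves the integral
of e over [T - h, T], which is about h e(T). Hence e(T) ≤ 0 (`nonpos_of_integral_increment_le`).

The required integrability of the flux and of the differences of w, over time and the pairs of
points that meet Ω, comes from `exists_lintegral_crossSet_le`. -/

/-! ### Time translations and increments over short windows. -/

/-- Continuity of translations in `L^q`, `1 ≤ q < ∞`. -/
theorem tendsto_eLpNorm_translate_sub {G : Type*} [NormedAddCommGroup G] [NormedSpace ℝ G]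
    [FiniteDimensional ℝ G] [MeasurableSpace G] [BorelSpace G] (μ : Measure G)
    [μ.IsAddHaarMeasure] {q : ℝ≥0∞} (hq : 1 ≤ q) (hq' : q ≠ ∞) {f : G → ℝ} (hf : MemLp f q μ) :
    Tendsto (fun a => eLpNorm (fun x => f (a + x) - f x) q μ) (𝓝 0) (𝓝 0) := by
  have : Fact (1 ≤ q) := ⟨hq⟩
  have : Fact (q ≠ ∞) := ⟨hq'⟩
  have h1 : Continuous fun a : G => DomAddAct.mk a +ᵥ hf.toLp f :=
    (continuous_id.vadd continuous_const).comp DomAddAct.continuous_mk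
  have h2 := (h1.tendsto 0).edist (tendsto_const_nhds (x := hf.toLp f))
  have h3 : DomAddAct.mk (0 : G) +ᵥ hf.toLp f = hf.toLp f := by
    rw [DomAddAct.mk_zero, zero_vadd]
  rw [h3, edist_self] at h2
  refine h2.congr fun a => ?_
  rw [DomAddAct.mk_vadd_toLp, Lp.edist_toLp_toLp]
  rfl

/-- Since f b ≥ 0 at equal times, the negative part of f(· - σ) b is at most |f(· - σ) - f| |b|.
Hölder's inequality and continuity of translations make its integral small. -/
theorem exists_lintegral_neg_translate_mul_le {Z : Type*} [NormedAddCommGroup Z] [NormedSpace ℝ Z]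
    [FiniteDimensional ℝ Z] [MeasurableSpace Z] [BorelSpace Z] (ν : Measure Z)
    [ν.IsAddHaarMeasure] {p q : ℝ} (hpq : p.HolderConjugate q) {f b : ℝ × Z → ℝ}
    (hf : MemLp f (ENNReal.ofReal q) ((volume : Measure ℝ).prod ν))
    (hb : MemLp b (ENNReal.ofReal p) ((volume : Measure ℝ).prod ν))
    (hfm : Measurable f) (hbm : Measurable b)
    (hfb : ∀ z, 0 ≤ f z * b z) {ε : ℝ≥0∞} (hε : 0 < ε) :
    ∃ δ : ℝ, 0 < δ ∧ ∀ σ : ℝ, |σ| < δ →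
      ∫⁻ z, ENNReal.ofReal (-(f (z.1 - σ, z.2) * b z)) ∂((volume : Measure ℝ).prod ν) ≤ ε := by
  set μ := (volume : Measure ℝ).prod ν
  have hq1 : 1 < q := hpq.symm.lt
  have hp1 : 1 < p := hpq.lt
  have hq0 : ENNReal.ofReal q ≠ 0 := by simp; linarith
  have hp0 : ENNReal.ofReal p ≠ 0 := by simp; linarith
  have h1 := tendsto_eLpNorm_translate_sub μ (q := ENNReal.ofReal q)
    (by rw [← ENNReal.ofReal_one]; exact ENNReal.ofReal_le_ofReal hq1.le) ENNReal.ofReal_ne_top hf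
  have h2 : Tendsto (fun a => eLpNorm (fun x => f (a + x) - f x) (ENNReal.ofReal q) μ
      * eLpNorm b (ENNReal.ofReal p) μ) (𝓝 0) (𝓝 0) := by
    have := ENNReal.Tendsto.mul_const h1 (b := eLpNorm b (ENNReal.ofReal p) μ)
      (Or.inr hb.eLpNorm_lt_top.ne)
    simpa using this
  have h3 : Tendsto (fun σ : ℝ => ((-σ, 0) : ℝ × Z)) (𝓝 0) (𝓝 0) := by
    have : Continuous (fun σ : ℝ => ((-σ, 0) : ℝ × Z)) := by fun_prop
    simpa only [neg_zero, Prod.mk_zero_zero] using this.tendsto 0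
  have h4 := (h2.comp h3).eventually (gt_mem_nhds hε)
  obtain ⟨δ, hδ, hδ'⟩ := Metric.eventually_nhds_iff.1 h4
  refine ⟨δ, hδ, fun σ hσ => ?_⟩
  have h5 := hδ' (y := σ) (by simpa [Real.dist_eq] using hσ)
  refine le_trans ?_ h5.le
  have hsub : ∀ z : ℝ × Z, ((-σ, 0) : ℝ × Z) + z = (z.1 - σ, z.2) := by
    intro z; ext <;> simp [sub_eq_neg_add]
  have hm : Measurable fun z : ℝ × Z => f (z.1 - σ, z.2) - f z := by fun_prop
  calc ∫⁻ z, ENNReal.ofReal (-(f (z.1 - σ, z.2) * b z)) ∂μ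
      ≤ ∫⁻ z, ((fun z => ‖f (z.1 - σ, z.2) - f z‖ₑ) * fun z => ‖b z‖ₑ) z ∂μ := by
        refine lintegral_mono fun z => ?_
        simp only [Pi.mul_apply]
        rw [← enorm_mul, ← ofReal_norm]
        refine ENNReal.ofReal_le_ofReal ?_
        have := hfb z
        have h6 := neg_abs_le ((f (z.1 - σ, z.2) - f z) * b z)
        rw [Real.norm_eq_abs]
        nlinarith
    _ ≤ _ := by
        refine (ENNReal.lintegral_mul_le_Lp_mul_Lq μ hpq.symm hm.enorm.aemeasurable
          hbm.enorm.aemeasurable).trans (le_of_eq ?_)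
        simp only [Function.comp]
        rw [eLpNorm_eq_lintegral_rpow_enorm_toReal hq0 ENNReal.ofReal_ne_top,
          eLpNorm_eq_lintegral_rpow_enorm_toReal hp0 ENNReal.ofReal_ne_top,
          ENNReal.toReal_ofReal (by linarith), ENNReal.toReal_ofReal (by linarith)]
        simp_rw [hsub]

/-- With τ = t - σ and the order of integration exchanged, this is the preceding bound integrated
over σ in [0, h]. -/
theorem exists_lintegral_window_neg_mul_le {Z : Type*} [NormedAddCommGroup Z] [NormedSpace ℝ Z]
    [FiniteDimensional ℝ Z] [MeasurableSpace Z] [BorelSpace Z] (ν : Measure Z)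
    [ν.IsAddHaarMeasure] {p q : ℝ} (hpq : p.HolderConjugate q) {f b : ℝ × Z → ℝ}
    (hf : MemLp f (ENNReal.ofReal q) ((volume : Measure ℝ).prod ν))
    (hb : MemLp b (ENNReal.ofReal p) ((volume : Measure ℝ).prod ν))
    (hfm : Measurable f) (hbm : Measurable b)
    (hfb : ∀ z, 0 ≤ f z * b z) {ε : ℝ≥0∞} (hε : 0 < ε) :
    ∃ δ : ℝ, 0 < δ ∧ ∀ h : ℝ, h < δ →
      ∫⁻ t : ℝ, ∫⁻ τ in Icc (t - h) t, ∫⁻ z, ENNReal.ofReal (-(f (τ, z) * b (t, z))) ∂ν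
        ≤ ε * ENNReal.ofReal h := by
  obtain ⟨δ, hδ, H⟩ := exists_lintegral_neg_translate_mul_le ν hpq hf hb hfm hbm hfb hε
  refine ⟨δ, hδ, fun h hh => ?_⟩
  have hm : Measurable fun x : (ℝ × ℝ) × Z =>
      ENNReal.ofReal (-(f (x.1.1 - x.1.2, x.2) * b (x.1.1, x.2))) := by fun_prop
  have hsub : ∀ t : ℝ, ∫⁻ τ in Icc (t - h) t, ∫⁻ z, ENNReal.ofReal (-(f (τ, z) * b (t, z))) ∂ν
      = ∫⁻ σ in Icc 0 h, ∫⁻ z, ENNReal.ofReal (-(f (t - σ, z) * b (t, z))) ∂ν := by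
    intro t
    rw [← lintegral_indicator measurableSet_Icc, ← lintegral_indicator measurableSet_Icc,
      ← lintegral_sub_left_eq_self _ t]
    refine lintegral_congr fun σ => ?_
    have : t - σ ∈ Icc (t - h) t ↔ σ ∈ Icc 0 h := by
      simp only [mem_Icc]; constructor <;> rintro ⟨h1, h2⟩ <;> constructor <;> linarith
    by_cases hσ : σ ∈ Icc 0 h
    · rw [indicator_of_mem (this.2 hσ), indicator_of_mem hσ]
    · rw [indicator_of_notMem (fun h' => hσ (this.1 h')), indicator_of_notMem hσ]
  simp_rw [hsub]
  rw [lintegral_lintegral_swap]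
  · calc _ ≤ ∫⁻ _ in Icc 0 h, ε := by
          refine setLIntegral_mono measurable_const fun σ hσ => ?_
          have h1 := H σ (by rw [abs_of_nonneg hσ.1]; exact hσ.2.trans_lt hh)
          rwa [lintegral_prod _ (by fun_prop)] at h1
      _ = _ := by simp
  · exact hm.lintegral_prod_right'.aemeasurable

/-- A continuous function that vanishes up to `t₀` and whose increments over short
windows are small in the mean is nonpositive. -/
theorem nonpos_of_integral_increment_le {e : ℝ → ℝ} (he : Continuous e) {t₀ T : ℝ}
    (h0 : ∀ t ≤ t₀, e t = 0)
    (H : ∀ ε : ℝ, 0 < ε → ∃ δ : ℝ, 0 < δ ∧ ∀ h, 0 < h → h < δ →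
      ∫ t in t₀..T, (e t - e (t - h)) ≤ ε * h) : e T ≤ 0 := by
  by_contra! hpos
  -- Near T the function exceeds e(T)/2, so its integral over the last window is at least h e(T)/2,
  -- which contradicts the bound h e(T)/4.
  obtain ⟨δ, hδ, H⟩ := H (e T / 4) (by linarith)
  have hnear : ∀ᶠ t in 𝓝 T, e T / 2 < e t :=
    (he.tendsto T).eventually (lt_mem_nhds (by linarith))
  obtain ⟨r, hr, hr'⟩ := Metric.eventually_nhds_iff.1 hnear
  set h := min δ r / 2
  have hh : 0 < h := by positivity
  have hhδ : h < δ := by have := min_le_left δ r; simp only [h]; linarith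
  have hhr : h < r := by have := min_le_right δ r; simp only [h]; linarith
  have hi : ∀ a b, IntervalIntegrable e volume a b := fun a b => he.intervalIntegrable a b
  -- The integral telescopes to the last window minus the window before `t₀`, where `e` vanishes.
  have h1 : ∫ t in t₀..T, (e t - e (t - h)) = ∫ t in (T - h)..T, e t := by
    rw [intervalIntegral.integral_sub (hi _ _)
      ((by fun_prop : Continuous fun t => e (t - h)).intervalIntegrable _ _),
      intervalIntegral.integral_comp_sub_right (fun t => e t) h]
    have h2 : ∫ t in (t₀ - h)..t₀, e t = 0 := by
      refine intervalIntegral.integral_zero_ae (ae_of_all _ fun t ht => h0 t ?_)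
      rw [uIoc_of_le (by linarith)] at ht
      exact ht.2
    have h3 := intervalIntegral.integral_add_adjacent_intervals (hi (t₀ - h) t₀) (hi t₀ T)
    have h4 := intervalIntegral.integral_add_adjacent_intervals (hi (t₀ - h) (T - h)) (hi (T - h) T)
    linarith
  have h2 : ∫ _ in (T - h)..T, e T / 2 ≤ ∫ t in (T - h)..T, e t := by
    refine intervalIntegral.integral_mono_on (by linarith) (by simp) (hi _ _) fun t ht => ?_
    refine (hr' ?_).le
    rw [Real.dist_eq, abs_lt]
    constructor <;> linarith [ht.1, ht.2]
  have h3 := H h hh hhδ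
  rw [h1] at h3
  simp at h2
  nlinarith

/-! ### Stability of the function spaces, and integrability over pairs meeting Ω. -/

namespace FracPLap

theorem gagliardo_congr_ae {N : ℕ} {s p : ℝ} {A : Set (Sp N)} {v w : Sp N → ℝ}
    (h : v =ᵐ[volume.restrict A] w) : gagliardo s p A v = gagliardo s p A w := by
  refine lintegral_congr_ae ?_
  filter_upwards [Measure.quasiMeasurePreserving_fst.ae_eq h,
    Measure.quasiMeasurePreserving_snd.ae_eq h] with z h1 h2
  simp only [Function.comp] at h1 h2
  rw [h1, h2]

theorem sobolevNorm_congr_ae {N : ℕ} {s p : ℝ} {A : Set (Sp N)} {v w : Sp N → ℝ}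
    (h : v =ᵐ[volume.restrict A] w) : sobolevNorm s p A v = sobolevNorm s p A w := by
  rw [sobolevNorm, sobolevNorm, gagliardo_congr_ae h, eLpNorm_congr_ae h]

theorem MemSobolev.congr_ae {N : ℕ} {s p : ℝ} {A : Set (Sp N)} {v w : Sp N → ℝ}
    (hv : MemSobolev s p A v) (h : v =ᵐ[volume.restrict A] w) : MemSobolev s p A w :=
  ⟨hv.1.congr h, sobolevNorm_congr_ae h ▸ hv.2⟩

theorem MemTail.congr_ae {N : ℕ} {q α : ℝ} {v w : Sp N → ℝ}
    (hv : MemTail q α v) (h : v =ᵐ[volume] w) : MemTail q α w := by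
  refine ⟨hv.1.congr h, lt_of_eq_of_lt ?_ hv.2⟩
  rw [tailNorm, tailNorm]
  congr 1
  refine lintegral_congr_ae ?_
  filter_upwards [h] with x hx
  rw [hx]

theorem gagliardo_mono {N : ℕ} {s p : ℝ} (hp : 0 ≤ p) {A : Set (Sp N)} {v w : Sp N → ℝ}
    (h : ∀ x y, |w x - w y| ≤ |v x - v y|) : gagliardo s p A w ≤ gagliardo s p A v := by
  refine lintegral_mono fun z => ENNReal.ofReal_le_ofReal ?_
  have := h z.1 z.2
  gcongr

theorem MemSobolev.mono {N : ℕ} {s p : ℝ} (hp : 0 < p) {A : Set (Sp N)} {v w : Sp N → ℝ}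
    (hv : MemSobolev s p A v) (hw : AEStronglyMeasurable w (volume.restrict A))
    (h : ∀ x, |w x| ≤ |v x|) (h' : ∀ x y, |w x - w y| ≤ |v x - v y|) : MemSobolev s p A w := by
  refine ⟨hw, lt_of_le_of_lt (add_le_add (eLpNorm_mono fun x => ?_) ?_) hv.2⟩
  · simpa using h x
  · exact ENNReal.rpow_le_rpow (gagliardo_mono hp.le h') (by positivity)

theorem MemTail.mono {N : ℕ} {q α : ℝ} (hq : 0 ≤ q) {v w : Sp N → ℝ}
    (hv : MemTail q α v) (hw : AEStronglyMeasurable w volume)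
    (h : ∀ x, |w x| ≤ |v x|) : MemTail q α w := by
  refine ⟨hw, lt_of_le_of_lt ?_ hv.2⟩
  refine ENNReal.rpow_le_rpow (lintegral_mono fun x => ENNReal.ofReal_le_ofReal ?_) (by positivity)
  have := h x
  gcongr

theorem sobolevNorm_neg {N : ℕ} {s p : ℝ} {A : Set (Sp N)} {v : Sp N → ℝ} :
    sobolevNorm s p A (-v) = sobolevNorm s p A v := by
  have h : gagliardo s p A (-v) = gagliardo s p A v := by
    refine lintegral_congr fun z => ?_
    rw [Pi.neg_apply, Pi.neg_apply, neg_sub_neg, abs_sub_comm]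
  rw [sobolevNorm, sobolevNorm, h, eLpNorm_neg]

theorem MemSobolev.neg {N : ℕ} {s p : ℝ} {A : Set (Sp N)} {v : Sp N → ℝ}
    (hv : MemSobolev s p A v) : MemSobolev s p A (-v) :=
  ⟨hv.1.neg, by rw [sobolevNorm_neg]; exact hv.2⟩

theorem MemTail.neg {N : ℕ} {q α : ℝ} {v : Sp N → ℝ}
    (hv : MemTail q α v) : MemTail q α (-v) := by
  refine ⟨hv.1.neg, ?_⟩
  have := hv.2
  simpa [tailNorm] using this

/-- The kernel `|x - y|^(-r)` is integrable away from the diagonal, uniformly in `x`. -/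
theorem exists_lintegral_kernel_le {N : ℕ} {r d : ℝ} (hr : (N : ℝ) < r) (hd : 0 < d) :
    ∃ C : ℝ≥0∞, C ≠ ∞ ∧ ∀ x : Sp N,
      ∫⁻ y in {y | d ≤ ‖x - y‖}, ENNReal.ofReal (1 / ‖x - y‖ ^ r) ≤ C := by
  have hr0 : 0 ≤ r := (Nat.cast_nonneg N).trans hr.le
  have hS : MeasurableSet {z : Sp N | d ≤ ‖z‖} := measurableSet_le measurable_const measurable_norm
  refine ⟨∫⁻ z : Sp N in {z | d ≤ ‖z‖}, ENNReal.ofReal (1 / ‖z‖ ^ r), ?_, fun x => ?_⟩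
  -- For ‖z‖ ≥ d one has 1/‖z‖ ≤ ((1 + d)/d)/(1 + ‖z‖), which reduces the kernel to an integrable
  -- power of 1 + ‖z‖.
  · have hint : Integrable (fun z : Sp N => ((1 + d) / d) ^ r * (1 + ‖z‖) ^ (-r)) :=
      (integrable_one_add_norm (by simpa using hr)).const_mul _
    refine ((lt_of_le_of_lt ?_ hint.lintegral_lt_top).ne)
    refine (setLIntegral_mono' hS fun z hz => ENNReal.ofReal_le_ofReal ?_).trans
      (setLIntegral_le_lintegral _ _)
    have hz' : d ≤ ‖z‖ := hz
    have hz0 : 0 < ‖z‖ := hd.trans_le hz'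
    rw [Real.rpow_neg (by positivity), ← div_eq_mul_inv, ← Real.div_rpow (by positivity)
      (by positivity), one_div, ← Real.inv_rpow hz0.le]
    refine Real.rpow_le_rpow (by positivity) ?_ hr0
    rw [inv_eq_one_div, div_div, div_le_div_iff₀ hz0 (by positivity)]
    nlinarith
  · have hS' : MeasurableSet {y : Sp N | d ≤ ‖x - y‖} :=
      measurableSet_le measurable_const (measurable_const.sub measurable_id).norm
    rw [← lintegral_indicator hS, ← lintegral_indicator hS',
      ← lintegral_sub_left_eq_self ({z : Sp N | d ≤ ‖z‖}.indicator _) x]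
    rfl

theorem abs_sub_rpow_le {a b M p : ℝ} (hp : 0 ≤ p) (hb : |b| ≤ M) :
    |a - b| ^ p ≤ 2 ^ p * (|a| ^ p + M ^ p) := by
  have hM : 0 ≤ M := (abs_nonneg b).trans hb
  have h1 : |a - b| ≤ 2 * max |a| M := by
    have := abs_sub a b
    have := le_max_left |a| M
    have := le_max_right |a| M
    linarith
  have h0 : 0 ≤ max |a| M := hM.trans (le_max_right _ _)
  calc |a - b| ^ p ≤ (2 * max |a| M) ^ p := Real.rpow_le_rpow (abs_nonneg _) h1 hp
    _ = 2 ^ p * (max |a| M) ^ p := Real.mul_rpow (by norm_num) h0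
    _ ≤ _ := by
      gcongr
      rcases max_choice |a| M with h | h <;> rw [h]
      · have : 0 ≤ M ^ p := by positivity
        linarith
      · have : 0 ≤ |a| ^ p := by positivity
        linarith

/-- The integrand of the Sobolev-Slobodeckii seminorm. -/
noncomputable def diffQuot {N : ℕ} (s p : ℝ) (v : Sp N → ℝ) (z : Sp N × Sp N) : ℝ :=
  |v z.1 - v z.2| ^ p / ‖z.1 - z.2‖ ^ ((N : ℝ) + s * p)

/-- The pairs of points that interact with `Ω`. -/
def crossSet {N : ℕ} (Ω : Set (Sp N)) : Set (Sp N × Sp N) := {z | z.1 ∈ Ω ∨ z.2 ∈ Ω}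

theorem measurableSet_crossSet {N : ℕ} {Ω : Set (Sp N)} (hΩ : MeasurableSet Ω) :
    MeasurableSet (crossSet Ω) :=
  (measurable_fst hΩ).union (measurable_snd hΩ)

theorem lintegral_rpow_le_sobolevNorm {N : ℕ} {s p : ℝ} (hp : 0 < p) {A : Set (Sp N)}
    {v : Sp N → ℝ} :
    ∫⁻ x in A, ENNReal.ofReal (|v x| ^ p) ≤ sobolevNorm s p A v ^ p := by
  have h : ∫⁻ x in A, ENNReal.ofReal (|v x| ^ p)
      = eLpNorm v (ENNReal.ofReal p) (volume.restrict A) ^ p := by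
    rw [eLpNorm_eq_lintegral_rpow_enorm_toReal (by simpa using hp) ENNReal.ofReal_ne_top,
      ENNReal.toReal_ofReal hp.le, ← ENNReal.rpow_mul, one_div_mul_cancel hp.ne', ENNReal.rpow_one]
    refine lintegral_congr fun x => ?_
    rw [← ENNReal.ofReal_rpow_of_nonneg (abs_nonneg _) hp.le, ← Real.norm_eq_abs,
      ofReal_norm]
  rw [h]
  exact ENNReal.rpow_le_rpow le_self_add hp.le

theorem gagliardo_le_sobolevNorm {N : ℕ} {s p : ℝ} (hp : 0 < p) {A : Set (Sp N)}
    {v : Sp N → ℝ} : gagliardo s p A v ≤ sobolevNorm s p A v ^ p := by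
  calc gagliardo s p A v = (gagliardo s p A v ^ (1 / p)) ^ p := by
        rw [← ENNReal.rpow_mul, one_div_mul_cancel hp.ne', ENNReal.rpow_one]
    _ ≤ _ := ENNReal.rpow_le_rpow le_add_self hp.le

/-- The seminorm on Ω' controls only pairs inside Ω' × Ω'. A pair meeting Ω but not contained in Ω'
has one point in Ω and the other outside Ω', at distance at least d > 0; there the kernel is
integrable and v is bounded by `M` at the outer point. The constant does not depend on v, so the
bound can be integrated in time. -/
theorem exists_lintegral_crossSet_le {N : ℕ} {s p : ℝ} (hs : 0 < s) (hp : 0 < p)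
    {Ω Ω' : Set (Sp N)} (hΩ : IsOpen Ω) (hΩ' : IsOpen Ω') (hΩ'b : Bornology.IsBounded Ω')
    (hΩΩ' : closure Ω ⊆ Ω') (M : ℝ) :
    ∃ C : ℝ≥0∞, C ≠ ∞ ∧ ∀ v : Sp N → ℝ, Measurable v → (∀ y ∉ Ω, |v y| ≤ M) →
      ∫⁻ z in crossSet Ω, ENNReal.ofReal (diffQuot s p v z)
        ≤ C * sobolevNorm s p Ω' v ^ p + C := by
  have hcomp : IsCompact (closure Ω) :=
    Metric.isCompact_of_isClosed_isBounded isClosed_closure (hΩ'b.subset hΩΩ')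
  obtain ⟨d, hd, hdΩ⟩ := hcomp.exists_thickening_subset_open hΩ' hΩΩ'
  obtain ⟨K, hK, hKb⟩ := exists_lintegral_kernel_le (N := N) (r := (N : ℝ) + s * p)
    (lt_add_of_pos_right _ (by positivity)) hd
  have hvol : volume Ω ≠ ∞ := (hΩ'b.subset (subset_closure.trans hΩΩ')).measure_lt_top.ne
  set c := ENNReal.ofReal (2 ^ p) * K
  have hc : c ≠ ∞ := ENNReal.mul_ne_top ENNReal.ofReal_ne_top hK
  set m := ENNReal.ofReal (M ^ p) * volume Ω
  have hm : m ≠ ∞ := ENNReal.mul_ne_top ENNReal.ofReal_ne_top hvol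
  refine ⟨(1 + 2 * c) * (1 + m), by finiteness, fun v hv hvM => ?_⟩
  set a := sobolevNorm s p Ω' v ^ p
  have hmeas : Measurable (fun z => ENNReal.ofReal (diffQuot s p v z)) := by
    unfold diffQuot; fun_prop
  have hsymm : ∀ x y, diffQuot s p v (x, y) = diffQuot s p v (y, x) := by
    intro x y
    simp only [diffQuot]
    rw [abs_sub_comm, norm_sub_rev]
  have hfar : ∀ x ∈ Ω, ∫⁻ y in Ω'ᶜ, ENNReal.ofReal (diffQuot s p v (x, y))
      ≤ c * (ENNReal.ofReal (|v x| ^ p) + ENNReal.ofReal (M ^ p)) := by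
    intro x hx
    have hsub : Ω'ᶜ ⊆ {y | d ≤ ‖x - y‖} := by
      intro y hy
      by_contra hlt
      refine hy (hdΩ ?_)
      rw [Metric.mem_thickening_iff]
      refine ⟨x, subset_closure hx, ?_⟩
      rw [dist_comm, dist_eq_norm]
      exact not_le.1 hlt
    calc ∫⁻ y in Ω'ᶜ, ENNReal.ofReal (diffQuot s p v (x, y))
        ≤ ∫⁻ y in Ω'ᶜ, ENNReal.ofReal (2 ^ p * (|v x| ^ p + M ^ p)) *
            ENNReal.ofReal (1 / ‖x - y‖ ^ ((N : ℝ) + s * p)) := by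
          refine setLIntegral_mono' hΩ'.measurableSet.compl fun y hy => ?_
          have hyM := hvM y fun h => hy (hΩΩ' (subset_closure h))
          have hM : 0 ≤ M := (abs_nonneg _).trans hyM
          rw [← ENNReal.ofReal_mul (by positivity), mul_one_div]
          refine ENNReal.ofReal_le_ofReal ?_
          simp only [diffQuot]
          have := abs_sub_rpow_le (a := v x) hp.le hyM
          gcongr
      _ ≤ ENNReal.ofReal (2 ^ p * (|v x| ^ p + M ^ p)) * K := by
          rw [lintegral_const_mul _ (by fun_prop)]
          gcongr
          exact (lintegral_mono_set hsub).trans (hKb x)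
      _ ≤ _ := by
          rw [ENNReal.ofReal_mul (by positivity), mul_right_comm]
          gcongr
          exact ENNReal.ofReal_add_le
  have hfar' : ∫⁻ x in Ω, ∫⁻ y in Ω'ᶜ, ENNReal.ofReal (diffQuot s p v (x, y))
      ≤ c * (a + m) := by
    calc _ ≤ ∫⁻ x in Ω, c * (ENNReal.ofReal (|v x| ^ p) + ENNReal.ofReal (M ^ p)) :=
          setLIntegral_mono' hΩ.measurableSet hfar
      _ = c * ((∫⁻ x in Ω, ENNReal.ofReal (|v x| ^ p)) + m) := by
          rw [lintegral_const_mul _ (by fun_prop), lintegral_add_right _ measurable_const,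
            setLIntegral_const]
      _ ≤ _ := by
          gcongr
          exact (lintegral_mono_set (subset_closure.trans hΩΩ')).trans
            (lintegral_rpow_le_sobolevNorm hp)
  have hcover : crossSet Ω ⊆ (Ω' ×ˢ Ω') ∪ ((Ω ×ˢ Ω'ᶜ) ∪ (Ω'ᶜ ×ˢ Ω)) := by
    rintro ⟨x, y⟩ h
    have hsub := subset_closure.trans hΩΩ'
    by_cases hx : x ∈ Ω' <;> by_cases hy : y ∈ Ω'
    · exact Or.inl ⟨hx, hy⟩
    · exact Or.inr (Or.inl ⟨h.resolve_right fun h' => hy (hsub h'), hy⟩)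
    · exact Or.inr (Or.inr ⟨hx, h.resolve_left fun h' => hx (hsub h')⟩)
    · exact (h.elim (fun h' => hx (hsub h')) fun h' => hy (hsub h')).elim
  have h1 : ∫⁻ z in Ω' ×ˢ Ω', ENNReal.ofReal (diffQuot s p v z) ≤ a := by
    rw [Measure.volume_eq_prod, ← Measure.prod_restrict]
    exact gagliardo_le_sobolevNorm hp
  have h2 : ∫⁻ z in Ω ×ˢ Ω'ᶜ, ENNReal.ofReal (diffQuot s p v z) ≤ c * (a + m) := by
    rw [Measure.volume_eq_prod, ← Measure.prod_restrict, lintegral_prod _ hmeas.aemeasurable]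
    exact hfar'
  have h3 : ∫⁻ z in Ω'ᶜ ×ˢ Ω, ENNReal.ofReal (diffQuot s p v z) ≤ c * (a + m) := by
    rw [Measure.volume_eq_prod, ← Measure.prod_restrict, lintegral_prod_symm _ hmeas.aemeasurable]
    simp_rw [hsymm]
    exact hfar'
  calc ∫⁻ z in crossSet Ω, ENNReal.ofReal (diffQuot s p v z)
      ≤ a + (c * (a + m) + c * (a + m)) :=
        (lintegral_mono_set hcover).trans ((lintegral_union_le _ _ _).trans
          (add_le_add h1 ((lintegral_union_le _ _ _).trans (add_le_add h2 h3))))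
    _ = (1 + 2 * c) * a + 2 * c * m := by ring
    _ ≤ (1 + 2 * c) * (1 + m) * a + (1 + 2 * c) * (1 + m) := by
        gcongr
        · exact le_mul_of_one_le_right' le_self_add
        · exact le_add_self
        · exact le_add_self

end FracPLap

/-! ### Sign and convexity inequalities. -/

/-- No integrability is needed: the integral of a nonintegrable function is 0 by convention. Thus
the nonlocal form can be estimated without first showing that its integrand is integrable. -/
theorem ofReal_neg_integral_le {α : Type*} [MeasurableSpace α] {μ : Measure α} (F : α → ℝ) :
    ENNReal.ofReal (-∫ x, F x ∂μ) ≤ ∫⁻ x, ENNReal.ofReal (-F x) ∂μ := by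
  by_cases hF : Integrable F μ
  · rw [← integral_neg, integral_eq_lintegral_pos_part_sub_lintegral_neg_part hF.fun_neg]
    refine (ENNReal.ofReal_le_ofReal (sub_le_self _ ENNReal.toReal_nonneg)).trans ?_
    exact ENNReal.ofReal_toReal_le
  · rw [integral_undef hF]
    simp

/-- The convex function ½(x - c)₊² has derivative (x - c)₊, and its graph lies above the tangent at
b. -/
theorem half_sq_max_sub_le (a b c : ℝ) :
    1 / 2 * max (b - c) 0 ^ 2 - 1 / 2 * max (a - c) 0 ^ 2 ≤ (b - a) * max (b - c) 0 := by
  rcases le_total (b - c) 0 with hb | hb <;> rcases le_total (a - c) 0 with ha | ha <;>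
    simp only [max_eq_left, max_eq_right, hb, ha] <;> nlinarith [sq_nonneg (a - b)]

theorem norm_sq_posPart_eq_integral {α : Type*} [MeasurableSpace α] {μ : Measure α}
    (f : Lp ℝ 2 μ) : ‖Lp.posPart f‖ ^ 2 = ∫ x, max (f x) 0 ^ 2 ∂μ := by
  rw [← real_inner_self_eq_norm_sq, L2.inner_def]
  refine integral_congr_ae ?_
  filter_upwards [Lp.coeFn_posPart f] with x hx
  simp [hx, sq]

theorem integrable_max_sq {α : Type*} [MeasurableSpace α] {μ : Measure α}
    (f : Lp ℝ 2 μ) : Integrable (fun x => max (f x) 0 ^ 2) μ := by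
  refine (L2.integrable_inner (𝕜 := ℝ) (Lp.posPart f) (Lp.posPart f)).congr ?_
  filter_upwards [Lp.coeFn_posPart f] with x hx
  simp [hx, sq]

theorem half_norm_sq_posPart_sub_le {α : Type*} [MeasurableSpace α] {μ : Measure α}
    (a b c : Lp ℝ 2 μ) :
    1 / 2 * ‖Lp.posPart (b - c)‖ ^ 2 - 1 / 2 * ‖Lp.posPart (a - c)‖ ^ 2
      ≤ ∫ x, (b x - a x) * max (b x - c x) 0 ∂μ := by
  rw [norm_sq_posPart_eq_integral, norm_sq_posPart_eq_integral, ← integral_const_mul,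
    ← integral_const_mul, ← integral_sub ((integrable_max_sq _).const_mul _)
      ((integrable_max_sq _).const_mul _)]
  refine integral_mono_ae (((integrable_max_sq _).const_mul _).sub
      ((integrable_max_sq _).const_mul _)) ?_ ?_
  · refine (L2.integrable_inner (𝕜 := ℝ) (Lp.posPart (b - c)) (b - a)).congr ?_
    filter_upwards [Lp.coeFn_posPart (b - c), Lp.coeFn_sub b c, Lp.coeFn_sub b a] with x h1 h2 h3
    simp only [h1, h2, h3, Pi.sub_apply, RCLike.inner_apply, conj_trivial]
  · filter_upwards [Lp.coeFn_sub b c, Lp.coeFn_sub a c] with x h1 h2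
    simp only [h1, h2, Pi.sub_apply]
    exact half_sq_max_sub_le _ _ _

namespace FracPLap

theorem abs_Jp {p : ℝ} (hp : 1 < p) (a : ℝ) : |Jp p a| = |a| ^ (p - 1) := by
  rw [Jp, abs_mul, abs_of_nonneg (by positivity : 0 ≤ |a| ^ (p - 2))]
  rcases eq_or_ne a 0 with rfl | ha
  · simp [Real.zero_rpow (by linarith : p - 1 ≠ 0)]
  · conv_lhs => rw [← Real.rpow_one |a|, ← Real.rpow_mul (abs_nonneg a), one_mul,
      ← Real.rpow_add (abs_pos.2 ha)]
    congr 1; ring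

theorem Jp_neg (p a : ℝ) : Jp p (-a) = -Jp p a := by simp [Jp]

/-- Both factors have the sign of a - b, because truncation is nondecreasing. -/
theorem Jp_sub_mul_max_nonneg (p a b M : ℝ) :
    0 ≤ Jp p (a - b) * (max (a - M) 0 - max (b - M) 0) := by
  have h : 0 ≤ |a - b| ^ (p - 2) := by positivity
  rw [Jp, mul_assoc]
  refine mul_nonneg h ?_
  rcases le_total a b with hab | hab
  · exact mul_nonneg_of_nonpos_of_nonpos (by linarith)
      (sub_nonpos.2 (max_le_max_right _ (by linarith)))
  · exact mul_nonneg (by linarith) (sub_nonneg.2 (max_le_max_right _ (by linarith)))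

/-- The truncation `(v - M)₊`. -/
def excess {X : Type*} (M : ℝ) (v : X → ℝ) (x : X) : ℝ := max (v x - M) 0

theorem abs_excess_le {X : Type*} {M : ℝ} (hM : 0 ≤ M) (v : X → ℝ) (x : X) :
    |excess M v x| ≤ |v x| := by
  rw [excess, abs_of_nonneg (le_max_right _ _)]
  exact max_le (by linarith [le_abs_self (v x)]) (abs_nonneg _)

theorem abs_excess_sub_le {X : Type*} (M : ℝ) (v : X → ℝ) (x y : X) :
    |excess M v x - excess M v y| ≤ |v x - v y| := by
  have := abs_max_sub_max_le_abs (v x - M) (v y - M) 0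
  simpa [excess] using this

theorem nonlocalForm_congr_ae {N : ℕ} {s p : ℝ} {v v' : Sp N → ℝ} (h : v =ᵐ[volume] v')
    (w : Sp N → ℝ) : nonlocalForm s p v w = nonlocalForm s p v' w := by
  refine integral_congr_ae ?_
  rw [Measure.volume_eq_prod]
  filter_upwards [Measure.quasiMeasurePreserving_fst.ae_eq h,
    Measure.quasiMeasurePreserving_snd.ae_eq h] with z h1 h2
  simp only [Function.comp] at h1 h2
  rw [h1, h2]

theorem nonlocalForm_neg {N : ℕ} {s p : ℝ} (v w : Sp N → ℝ) :
    nonlocalForm s p (-v) w = -nonlocalForm s p v w := by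
  rw [nonlocalForm, nonlocalForm, ← integral_neg]
  refine integral_congr_ae (ae_of_all _ fun z => ?_)
  simp only [Pi.neg_apply]
  rw [neg_sub_neg, ← neg_sub (v z.1), Jp_neg]
  ring

/-! ### Solutions tested by functions independent of time, and their weighted fluxes. -/

/-- A curve `u` in `L²(Ω)`, bounded by `M` outside of `Ω` and at the initial time, that satisfies
the weak formulation of `∂ₜu + (-Δ_p)^s u = 0` for test functions that do not depend on time;
`U` is a jointly measurable representative of `u`. -/
structure IsTestedByConstants {N : ℕ} (s p : ℝ) (Ω Ω' : Set (Sp N)) (t₀ t₁ M : ℝ)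
    (u : ℝ → Sp N → ℝ) (U : ℝ × Sp N → ℝ)
    (V : ℝ → Lp ℝ 2 ((volume : Measure (Sp N)).restrict Ω)) : Prop where
  lpSobolev : ∀ᵐ t ∂(volume.restrict (Icc t₀ t₁)), MemSobolev s p Ω' (u t)
  finite : ∫⁻ t in Icc t₀ t₁, sobolevNorm s p Ω' (u t) ^ p < ∞
  tail : ∀ᵐ t ∂(volume.restrict (Icc t₀ t₁)), MemTail (p - 1) (s * p) (u t)
  rep_meas : Measurable U
  rep_bound : ∀ t, ∀ y ∉ Ω, |U (t, y)| ≤ M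
  rep_ae : ∀ᵐ t ∂(volume.restrict (Icc t₀ t₁)), u t =ᵐ[volume] fun x => U (t, x)
  curve : IsL2Curve Ω (Icc t₀ t₁) u V
  cont : ContinuousOn V (Icc t₀ t₁)
  initial : ∀ᵐ x ∂(volume.restrict Ω), |u t₀ x| ≤ M
  weak : ∀ T₀ T₁ : ℝ, T₀ < T₁ → Icc T₀ T₁ ⊆ Icc t₀ t₁ → ∀ w : Sp N → ℝ,
    MemX s p Ω Ω' 0 w → MemLp w 2 (volume.restrict Ω) →
      ∫ t in Icc T₀ T₁, nonlocalForm s p (u t) w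
        = (∫ x in Ω, u T₀ x * w x) - ∫ x in Ω, u T₁ x * w x

theorem IsTestedByConstants.neg {N : ℕ} {s p : ℝ} {Ω Ω' : Set (Sp N)} {t₀ t₁ M : ℝ}
    {u : ℝ → Sp N → ℝ} {U : ℝ × Sp N → ℝ}
    {V : ℝ → Lp ℝ 2 ((volume : Measure (Sp N)).restrict Ω)}
    (h : IsTestedByConstants s p Ω Ω' t₀ t₁ M u U V) :
    IsTestedByConstants s p Ω Ω' t₀ t₁ M (-u) (-U) (-V) where
  lpSobolev := h.lpSobolev.mono fun t ht => ht.neg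
  finite := by simpa only [Pi.neg_apply, sobolevNorm_neg] using h.finite
  tail := h.tail.mono fun t ht => ht.neg
  rep_meas := h.rep_meas.neg
  rep_bound t y hy := by simpa using h.rep_bound t y hy
  rep_ae := h.rep_ae.mono fun t ht => ht.fun_neg
  curve t ht := (Lp.coeFn_neg (V t)).trans (h.curve t ht).neg
  cont := h.cont.neg
  initial := by simpa using h.initial
  weak T₀ T₁ hT hsub w hw hw2 := by
    have := h.weak T₀ T₁ hT hsub w hw hw2
    simp only [Pi.neg_apply, nonlocalForm_neg, integral_neg, neg_mul, this]
    ring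

section Core

variable {N : ℕ} {s p : ℝ} {Ω Ω' : Set (Sp N)} {t₀ t₁ M : ℝ}
  {u : ℝ → Sp N → ℝ} {U : ℝ × Sp N → ℝ}
  {V : ℝ → Lp ℝ 2 ((volume : Measure (Sp N)).restrict Ω)}

/-- The flux of `U`, weighted by the power `1/q` of the kernel. -/
noncomputable def weightedFlux (s p q : ℝ) (Ω : Set (Sp N)) (I : Set ℝ) (U : ℝ × Sp N → ℝ) :
    ℝ × (Sp N × Sp N) → ℝ :=
  (I ×ˢ crossSet Ω).indicator fun z =>
    Jp p (U (z.1, z.2.1) - U (z.1, z.2.2)) / (‖z.2.1 - z.2.2‖ ^ ((N : ℝ) + s * p)) ^ (1 / q)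

/-- The differences of the excess of `U`, weighted by the power `1/p` of the kernel. -/
noncomputable def weightedExcess (s p M : ℝ) (Ω : Set (Sp N)) (I : Set ℝ) (U : ℝ × Sp N → ℝ) :
    ℝ × (Sp N × Sp N) → ℝ :=
  (I ×ˢ crossSet Ω).indicator fun z =>
    (excess M U (z.1, z.2.1) - excess M U (z.1, z.2.2))
      / (‖z.2.1 - z.2.2‖ ^ ((N : ℝ) + s * p)) ^ (1 / p)

theorem measurable_Jp (p : ℝ) : Measurable (Jp p) := by unfold Jp; fun_prop

theorem measurable_weightedFlux {q : ℝ} {I : Set ℝ} (hI : MeasurableSet I)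
    (hΩ : MeasurableSet Ω) (hU : Measurable U) : Measurable (weightedFlux s p q Ω I U) := by
  refine Measurable.indicator ?_ (hI.prod (measurableSet_crossSet hΩ))
  have := measurable_Jp p
  fun_prop

theorem measurable_weightedExcess {I : Set ℝ} (hI : MeasurableSet I)
    (hΩ : MeasurableSet Ω) (hU : Measurable U) : Measurable (weightedExcess s p M Ω I U) := by
  refine Measurable.indicator ?_ (hI.prod (measurableSet_crossSet hΩ))
  unfold excess
  fun_prop

/-- The powers 1/q and 1/p of the kernel recombine to the kernel itself. Restricting to pairs that
meet Ω loses nothing, since the excess vanishes at both points of any other pair. -/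
theorem weightedFlux_mul_weightedExcess {q : ℝ} (hpq : p.HolderConjugate q) {I : Set ℝ}
    (hUM : ∀ t, ∀ y ∉ Ω, U (t, y) ≤ M) {τ t : ℝ} (hτ : τ ∈ I) (ht : t ∈ I) (z : Sp N × Sp N) :
    weightedFlux s p q Ω I U (τ, z) * weightedExcess s p M Ω I U (t, z)
      = Jp p (U (τ, z.1) - U (τ, z.2)) * (excess M U (t, z.1) - excess M U (t, z.2))
        / ‖z.1 - z.2‖ ^ ((N : ℝ) + s * p) := by
  by_cases hz : z ∈ crossSet Ω
  · rw [weightedFlux, weightedExcess, indicator_of_mem (mk_mem_prod hτ hz),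
      indicator_of_mem (mk_mem_prod ht hz),
      div_mul_div_comm, ← Real.rpow_add_of_nonneg (by positivity)
        (one_div_nonneg.2 hpq.symm.pos.le) (one_div_nonneg.2 hpq.pos.le)]
    have : 1 / q + 1 / p = 1 := by
      rw [one_div, one_div]; exact hpq.symm.inv_add_inv_eq_one
    rw [this, Real.rpow_one]
  · have hz' : z.1 ∉ Ω ∧ z.2 ∉ Ω := not_or.1 hz
    have h1 : excess M U (t, z.1) = 0 := max_eq_right (by linarith [hUM t _ hz'.1])
    have h2 : excess M U (t, z.2) = 0 := max_eq_right (by linarith [hUM t _ hz'.2])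
    rw [h1, h2, weightedFlux, indicator_of_notMem (fun h => hz h.2)]
    simp

theorem weightedFlux_mul_weightedExcess_nonneg (q : ℝ) (I : Set ℝ)
    (z : ℝ × (Sp N × Sp N)) :
    0 ≤ weightedFlux s p q Ω I U z * weightedExcess s p M Ω I U z := by
  by_cases hz : z ∈ I ×ˢ crossSet Ω
  · rw [weightedFlux, weightedExcess, indicator_of_mem hz, indicator_of_mem hz, div_mul_div_comm]
    exact div_nonneg (Jp_sub_mul_max_nonneg _ _ _ _) (by positivity)
  · rw [weightedFlux, indicator_of_notMem hz, zero_mul]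

theorem IsTestedByConstants.lintegral_diffQuot_lt_top
    (h : IsTestedByConstants s p Ω Ω' t₀ t₁ M u U V) (hs : 0 < s) (hp : 0 < p)
    (hΩ : IsOpen Ω) (hΩ' : IsOpen Ω') (hΩ'b : Bornology.IsBounded Ω') (hΩΩ' : closure Ω ⊆ Ω') :
    ∫⁻ z in Icc t₀ t₁ ×ˢ crossSet Ω,
      ENNReal.ofReal (diffQuot s p (fun x => U (z.1, x)) z.2)
        ∂((volume : Measure ℝ).prod (volume : Measure (Sp N × Sp N))) < ∞ := by
  obtain ⟨C, hC, H⟩ := exists_lintegral_crossSet_le (N := N) hs hp hΩ hΩ' hΩ'b hΩΩ' M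
  have hU := h.rep_meas
  rw [← Measure.prod_restrict, lintegral_prod _
    (by unfold diffQuot; exact Measurable.aemeasurable (by fun_prop))]
  have hle : ∀ᵐ t ∂(volume.restrict (Icc t₀ t₁)),
      ∫⁻ z in crossSet Ω, ENNReal.ofReal (diffQuot s p (fun x => U (t, x)) z)
        ≤ C * sobolevNorm s p Ω' (u t) ^ p + C := by
    filter_upwards [h.rep_ae] with t ht
    rw [sobolevNorm_congr_ae (ae_restrict_of_ae ht)]
    exact H _ (by fun_prop) (h.rep_bound t)
  refine (lintegral_mono_ae hle).trans_lt ?_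
  rw [lintegral_add_right _ measurable_const, lintegral_const_mul' _ _ hC]
  have h1 : C * ∫⁻ t in Icc t₀ t₁, sobolevNorm s p Ω' (u t) ^ p < ∞ :=
    ENNReal.mul_lt_top hC.lt_top h.finite
  have h2 : ∫⁻ _ in Icc t₀ t₁, C < ∞ := by
    rw [setLIntegral_const]
    exact ENNReal.mul_lt_top hC.lt_top (by simp)
  exact ENNReal.add_lt_top.2 ⟨h1, h2⟩

theorem memLp_of_rpow_le_indicator {X : Type*} [MeasurableSpace X] {μ : Measure X} {q : ℝ}
    (hq : 0 < q) {f F : X → ℝ} (hf : Measurable f) {S : Set X} (hS : MeasurableSet S)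
    (hF : ∫⁻ x in S, ENNReal.ofReal (F x) ∂μ < ∞)
    (h0 : ∀ x ∉ S, f x = 0) (h1 : ∀ x ∈ S, |f x| ^ q ≤ F x) :
    MemLp f (ENNReal.ofReal q) μ := by
  refine ⟨hf.aestronglyMeasurable, ?_⟩
  rw [eLpNorm_lt_top_iff_lintegral_rpow_enorm_lt_top (by simpa using hq) ENNReal.ofReal_ne_top,
    ENNReal.toReal_ofReal hq.le]
  refine lt_of_le_of_lt ?_ hF
  rw [← lintegral_indicator hS]
  refine lintegral_mono fun x => ?_
  by_cases hx : x ∈ S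
  · rw [indicator_of_mem hx, ← ofReal_norm, ENNReal.ofReal_rpow_of_nonneg (norm_nonneg _) hq.le]
    exact ENNReal.ofReal_le_ofReal (h1 x hx)
  · simp [h0 x hx, hq]

/-- As (p - 1) q = p, the q-th power of the weighted flux is exactly `diffQuot`. -/
theorem IsTestedByConstants.memLp_weightedFlux {q : ℝ}
    (h : IsTestedByConstants s p Ω Ω' t₀ t₁ M u U V) (hs : 0 < s) (hpq : p.HolderConjugate q)
    (hΩ : IsOpen Ω) (hΩ' : IsOpen Ω') (hΩ'b : Bornology.IsBounded Ω') (hΩΩ' : closure Ω ⊆ Ω') :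
    MemLp (weightedFlux s p q Ω (Icc t₀ t₁) U) (ENNReal.ofReal q)
      ((volume : Measure ℝ).prod (volume : Measure (Sp N × Sp N))) := by
  refine memLp_of_rpow_le_indicator hpq.symm.pos
    (measurable_weightedFlux measurableSet_Icc hΩ.measurableSet h.rep_meas)
    (measurableSet_Icc.prod (measurableSet_crossSet hΩ.measurableSet))
    (h.lintegral_diffQuot_lt_top hs hpq.pos hΩ hΩ' hΩ'b hΩΩ')
    (fun z hz => indicator_of_notMem hz _) fun z hz => le_of_eq ?_
  rw [weightedFlux, indicator_of_mem hz, abs_div, abs_Jp hpq.lt, diffQuot,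
    Real.div_rpow (by positivity) (abs_nonneg _), abs_of_nonneg (by positivity : 0 ≤
      (‖z.2.1 - z.2.2‖ ^ ((N : ℝ) + s * p)) ^ (1 / q)), ← Real.rpow_mul (abs_nonneg _),
    ← Real.rpow_mul (by positivity) (1 / q), one_div_mul_cancel hpq.symm.pos.ne', Real.rpow_one,
    hpq.sub_one_mul_conj]

theorem IsTestedByConstants.memLp_weightedExcess
    (h : IsTestedByConstants s p Ω Ω' t₀ t₁ M u U V) (hs : 0 < s) (hp : 0 < p)
    (hΩ : IsOpen Ω) (hΩ' : IsOpen Ω') (hΩ'b : Bornology.IsBounded Ω') (hΩΩ' : closure Ω ⊆ Ω') :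
    MemLp (weightedExcess s p M Ω (Icc t₀ t₁) U) (ENNReal.ofReal p)
      ((volume : Measure ℝ).prod (volume : Measure (Sp N × Sp N))) := by
  refine memLp_of_rpow_le_indicator hp
    (measurable_weightedExcess measurableSet_Icc hΩ.measurableSet h.rep_meas)
    (measurableSet_Icc.prod (measurableSet_crossSet hΩ.measurableSet))
    (h.lintegral_diffQuot_lt_top hs hp hΩ hΩ' hΩ'b hΩΩ')
    (fun z hz => indicator_of_notMem hz _) fun z hz => ?_
  rw [weightedExcess, indicator_of_mem hz, abs_div, diffQuot,
    Real.div_rpow (abs_nonneg _) (abs_nonneg _), abs_of_nonneg (by positivity : 0 ≤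
      (‖z.2.1 - z.2.2‖ ^ ((N : ℝ) + s * p)) ^ (1 / p)),
    ← Real.rpow_mul (by positivity) (1 / p), one_div_mul_cancel hp.ne', Real.rpow_one]
  have := abs_excess_sub_le M U (z.1, z.2.1) (z.1, z.2.2)
  gcongr

end Core

/-! ### The energy inequality and the one-sided bound. -/

/-- The test function is the excess frozen at the right endpoint t, where the tangent inequality for
½(x - M)₊² bounds the increment from above. Only t has to avoid a null set; r is arbitrary, because
V is the continuous curve and agrees with u at every time. -/
theorem IsTestedByConstants.energy_le {N : ℕ} {s p q : ℝ} {Ω Ω' : Set (Sp N)} {t₀ t₁ M : ℝ}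
    {u : ℝ → Sp N → ℝ} {U : ℝ × Sp N → ℝ}
    {V : ℝ → Lp ℝ 2 ((volume : Measure (Sp N)).restrict Ω)}
    [IsFiniteMeasure ((volume : Measure (Sp N)).restrict Ω)]
    (h : IsTestedByConstants s p Ω Ω' t₀ t₁ M u U V) (hM : 0 ≤ M) (hpq : p.HolderConjugate q)
    (hΩ : MeasurableSet Ω) :
    ∀ᵐ t ∂(volume.restrict (Icc t₀ t₁)), ∀ r ∈ Ico t₀ t,
      ENNReal.ofReal (1 / 2 * ‖Lp.posPart (V t - Lp.const 2 _ M)‖ ^ 2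
          - 1 / 2 * ‖Lp.posPart (V r - Lp.const 2 _ M)‖ ^ 2)
        ≤ ∫⁻ τ in Icc r t, ∫⁻ z, ENNReal.ofReal
          (-(weightedFlux s p q Ω (Icc t₀ t₁) U (τ, z)
            * weightedExcess s p M Ω (Icc t₀ t₁) U (t, z))) := by
  filter_upwards [h.rep_ae, h.lpSobolev, h.tail, ae_restrict_mem measurableSet_Icc]
    with t hrep hsob htail ht r hr
  have hrI : r ∈ Icc t₀ t₁ := ⟨hr.1, hr.2.le.trans ht.2⟩
  have hsub : Icc r t ⊆ Icc t₀ t₁ := Icc_subset_Icc hr.1 ht.2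
  set w : Sp N → ℝ := fun x => excess M U (t, x)
  have hwm : Measurable w := by
    have := h.rep_meas
    simp only [w, excess]
    fun_prop
  have hle : ∀ x, |w x| ≤ |U (t, x)| := fun x => abs_excess_le hM U (t, x)
  have hw : MemX s p Ω Ω' 0 w :=
    { sobolev := (hsob.congr_ae (ae_restrict_of_ae hrep)).mono hpq.pos hwm.aestronglyMeasurable
        hle fun x y => abs_excess_sub_le M U (t, x) (t, y)
      tail := (htail.congr_ae hrep).mono (sub_nonneg.2 hpq.lt.le) hwm.aestronglyMeasurable hle
      eq_outside := by
        filter_upwards [ae_restrict_mem hΩ.compl] with x hx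
        exact max_eq_right (by linarith [le_abs_self (U (t, x)), h.rep_bound t x hx]) }
  have hVU : ∀ᵐ x ∂(volume.restrict Ω), V t x = U (t, x) := by
    filter_upwards [h.curve t ht, ae_restrict_of_ae hrep] with x h1 h2
    rw [h1, h2]
  have hw2 : MemLp w 2 (volume.restrict Ω) := by
    refine (Lp.memLp (V t)).mono hwm.aestronglyMeasurable ?_
    filter_upwards [hVU] with x hx
    rw [Real.norm_eq_abs, Real.norm_eq_abs, hx]
    exact hle x
  have hint : ∀ T ∈ Icc t₀ t₁, Integrable (fun x => u T x * w x) (volume.restrict Ω) :=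
    fun T hT => ((memLp_congr_ae (h.curve T hT)).1 (Lp.memLp (V T))).integrable_mul hw2
  have hweak := h.weak r t hr.2 hsub w hw hw2
  have henergy : 1 / 2 * ‖Lp.posPart (V t - Lp.const 2 _ M)‖ ^ 2
      - 1 / 2 * ‖Lp.posPart (V r - Lp.const 2 _ M)‖ ^ 2
        ≤ -∫ τ in Icc r t, nonlocalForm s p (u τ) w := by
    refine (half_norm_sq_posPart_sub_le _ _ _).trans (le_of_eq ?_)
    rw [hweak, neg_sub, ← integral_sub (hint t ht) (hint r hrI)]
    refine integral_congr_ae ?_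
    filter_upwards [h.curve t ht, h.curve r hrI, hVU,
      Lp.coeFn_const (p := 2) (μ := (volume : Measure (Sp N)).restrict Ω) M] with x h1 h2 h3 h4
    simp only [w, excess]
    rw [h4, Function.const_apply, h3, ← h3, h1, h2, ← h1, h3]
    ring
  calc _ ≤ ENNReal.ofReal (-∫ τ in Icc r t, nonlocalForm s p (u τ) w) :=
        ENNReal.ofReal_le_ofReal henergy
    _ ≤ ∫⁻ τ in Icc r t, ENNReal.ofReal (-nonlocalForm s p (u τ) w) := ofReal_neg_integral_le _
    _ ≤ _ := by
      refine lintegral_mono_ae ?_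
      filter_upwards [ae_restrict_of_ae_restrict_of_subset hsub h.rep_ae,
        ae_restrict_mem measurableSet_Icc] with τ hτ hτI
      rw [nonlocalForm_congr_ae hτ]
      refine (ofReal_neg_integral_le _).trans (le_of_eq (lintegral_congr fun z => ?_))
      rw [weightedFlux_mul_weightedExcess hpq
        (fun t y hy => (le_abs_self _).trans (h.rep_bound t y hy)) (hsub hτI) ht]

theorem IsTestedByConstants.ae_le {N : ℕ} {s p q : ℝ} {Ω Ω' : Set (Sp N)} {t₀ t₁ M : ℝ}
    {u : ℝ → Sp N → ℝ} {U : ℝ × Sp N → ℝ}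
    {V : ℝ → Lp ℝ 2 ((volume : Measure (Sp N)).restrict Ω)}
    (h : IsTestedByConstants s p Ω Ω' t₀ t₁ M u U V) (hM : 0 ≤ M) (hs : 0 < s)
    (hpq : p.HolderConjugate q) (ht : t₀ ≤ t₁)
    (hΩ : IsOpen Ω) (hΩ' : IsOpen Ω') (hΩ'b : Bornology.IsBounded Ω') (hΩΩ' : closure Ω ⊆ Ω')
    {T : ℝ} (hT : T ∈ Icc t₀ t₁) : ∀ᵐ x ∂(volume.restrict Ω), u T x ≤ M := by
  have : IsFiniteMeasure ((volume : Measure (Sp N)).restrict Ω) :=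
    isFiniteMeasure_restrict.2
      (hΩ'b.subset (subset_closure.trans hΩΩ')).measure_lt_top.ne
  have : (volume : Measure (Sp N × Sp N)).IsAddHaarMeasure := by
    rw [Measure.volume_eq_prod]
    infer_instance
  set c : Lp ℝ 2 ((volume : Measure (Sp N)).restrict Ω) := Lp.const 2 _ M
  have hc : ∀ᵐ x ∂(volume.restrict Ω), c x = M := Lp.coeFn_const (p := 2) (μ := volume.restrict Ω) M
  -- Extending V by its endpoint values makes e continuous on the whole line and zero before `t₀`,
  -- since V t₀ ≤ M.
  set e : ℝ → ℝ := fun t => 1 / 2 * ‖Lp.posPart (IccExtend ht ((Icc t₀ t₁).domRestrict V) t - c)‖ ^ 2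
  have heq : ∀ t ∈ Icc t₀ t₁, e t = 1 / 2 * ‖Lp.posPart (V t - c)‖ ^ 2 := by
    intro t hte
    simp only [e]
    rw [IccExtend_of_mem _ _ hte, Set.domRestrict_apply]
  have hcont : Continuous e := by
    have h1 : Continuous (IccExtend ht ((Icc t₀ t₁).domRestrict V)) := h.cont.domRestrict.Icc_extend'
    have h2 := Lp.continuous_posPart.comp (h1.sub (continuous_const (y := c)))
    exact continuous_const.mul (h2.norm.pow 2)
  have hVinit : Lp.posPart (V t₀ - c) = 0 := by
    refine Lp.ext ?_
    filter_upwards [Lp.coeFn_posPart (V t₀ - c), Lp.coeFn_sub (V t₀) c, hc, h.initial,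
      h.curve t₀ (left_mem_Icc.2 ht), Lp.coeFn_zero ℝ 2 ((volume : Measure (Sp N)).restrict Ω)]
      with x h1 h2 h3 h4 h5 h6
    rw [h1, h2, h6, Pi.sub_apply, h3, h5]
    exact max_eq_right (by linarith [le_abs_self (u t₀ x)])
  have he0 : ∀ t ≤ t₀, e t = 0 := by
    intro t hte
    simp only [e]
    rw [IccExtend_of_le_left _ _ hte, Set.domRestrict_apply, hVinit, norm_zero]
    norm_num
  have hf := h.memLp_weightedFlux hs hpq hΩ hΩ' hΩ'b hΩΩ'
  have hb := h.memLp_weightedExcess hs hpq.pos hΩ hΩ' hΩ'b hΩΩ'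
  have heT : e T ≤ 0 := by
    refine nonpos_of_integral_increment_le hcont he0 fun ε hε => ?_
    obtain ⟨δ, hδ, H⟩ := exists_lintegral_window_neg_mul_le (volume : Measure (Sp N × Sp N)) hpq
      hf hb (measurable_weightedFlux measurableSet_Icc hΩ.measurableSet h.rep_meas)
      (measurable_weightedExcess measurableSet_Icc hΩ.measurableSet h.rep_meas)
      (weightedFlux_mul_weightedExcess_nonneg q (Icc t₀ t₁)) (ENNReal.ofReal_pos.2 hε)
    refine ⟨δ, hδ, fun k hk hkδ => ?_⟩
    have hH := H k hkδ
    rw [← ENNReal.ofReal_mul hε.le] at hH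
    rw [← ENNReal.ofReal_le_ofReal_iff (by positivity), intervalIntegral.integral_of_le hT.1]
    refine le_trans ?_ hH
    -- The double negation brings the integral of the increments into the form of
    -- `ofReal_neg_integral_le`.
    have hsign := ofReal_neg_integral_le (μ := volume.restrict (Ioc t₀ T))
      fun t => -(e t - e (t - k))
    rw [integral_neg, neg_neg] at hsign
    simp only [neg_neg] at hsign
    refine hsign.trans (le_trans ?_ (setLIntegral_le_lintegral (Ioc t₀ T) _))
    refine lintegral_mono_ae ?_
    have hsub : Ioc t₀ T ⊆ Icc t₀ t₁ := fun t htT => ⟨htT.1.le, htT.2.trans hT.2⟩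
    filter_upwards [ae_restrict_of_ae_restrict_of_subset hsub (h.energy_le hM hpq hΩ.measurableSet),
      ae_restrict_mem measurableSet_Ioc] with t hen htT
    -- The equation holds only after `t₀`, so the window is cut there; e is unchanged because it
    -- vanishes up to `t₀`. The bound is afterwards enlarged to the full window.
    have hr : max (t - k) t₀ ∈ Ico t₀ t := ⟨le_max_right _ _, max_lt (by linarith) htT.1⟩
    have her : e (t - k) = e (max (t - k) t₀) := by
      rcases le_total (t - k) t₀ with hle | hle
      · rw [max_eq_right hle, he0 _ hle, he0 _ le_rfl]
      · rw [max_eq_left hle]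
    rw [her, heq t (hsub htT), heq _ ⟨hr.1, hr.2.le.trans (hsub htT).2⟩]
    exact (hen _ hr).trans (lintegral_mono_set (Icc_subset_Icc_left (le_max_left _ _)))
  have hzero : Lp.posPart (V T - c) = 0 := by
    rw [heq T hT] at heT
    have h1 : ‖Lp.posPart (V T - c)‖ ^ 2 = 0 := le_antisymm (by linarith) (by positivity)
    exact norm_eq_zero.1 (pow_eq_zero_iff (two_ne_zero)|>.1 h1)
  filter_upwards [Lp.coeFn_posPart (V T - c), Lp.coeFn_sub (V T) c, hc, h.curve T hT,
    Lp.coeFn_zero ℝ 2 ((volume : Measure (Sp N)).restrict Ω)] with x h1 h2 h3 h4 h5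
  rw [hzero, h2, Pi.sub_apply, h3, h4, h5] at h1
  have := le_max_left (u T x - M) 0
  rw [← h1] at this
  simpa using this

/-! ### From weak solutions to the tested formulation. -/

theorem MemX.isTest_const {N : ℕ} {s p : ℝ} (hp : 0 < p) {Ω Ω' : Set (Sp N)} {w : Sp N → ℝ}
    (hw : MemX s p Ω Ω' 0 w) (hw2 : MemLp w 2 (volume.restrict Ω)) (T₀ T₁ : ℝ) :
    IsTest s p Ω Ω' (Icc T₀ T₁) (fun _ => w) (fun _ => hw2.toLp w) where
  meas := by
    have h : AEStronglyMeasurable w ((volume : Measure (Sp N)).restrict univ) := by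
      simpa using hw.tail.1
    exact h.comp_snd
  lpSobolev :=
    { meas := hw.sobolev.1.comp_snd
      mem := ae_of_all _ fun _ => hw.sobolev
      finite := by
        rw [setLIntegral_const]
        exact ENNReal.mul_lt_top (ENNReal.rpow_lt_top_of_nonneg hp.le hw.sobolev.2.ne) (by simp) }
  memX := ae_of_all _ fun _ => hw
  curve _ _ := hw2.coeFn_toLp
  contDiff := contDiffOn_const

theorem IsWeakSolution.weak_const {N : ℕ} {s p t₀ t₁ : ℝ} {Ω Ω' : Set (Sp N)}
    {g u : ℝ → Sp N → ℝ} {u₀ : Sp N → ℝ} (hu : IsWeakSolution s p Ω Ω' t₀ t₁ g u₀ u)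
    (hp : 0 < p) {T₀ T₁ : ℝ} (hT : T₀ < T₁) (hsub : Icc T₀ T₁ ⊆ Icc t₀ t₁) {w : Sp N → ℝ}
    (hw : MemX s p Ω Ω' 0 w) (hw2 : MemLp w 2 (volume.restrict Ω)) :
    ∫ t in Icc T₀ T₁, nonlocalForm s p (u t) w
      = (∫ x in Ω, u T₀ x * w x) - ∫ x in Ω, u T₁ x * w x := by
  rw [← hu.weak T₀ T₁ hT hsub _ _ (hw.isTest_const hp hw2 T₀ T₁)]
  have h0 : ∀ t, ∫ x in Ω, u t x
      * (derivWithin (fun _ : ℝ => hw2.toLp w) (Icc T₀ T₁) t) x = 0 := by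
    intro t
    rw [derivWithin_fun_const]
    refine integral_eq_zero_of_ae ?_
    filter_upwards [Lp.coeFn_zero ℝ 2 ((volume : Measure (Sp N)).restrict Ω)] with x hx
    simp only [Pi.zero_apply] at hx ⊢
    rw [hx, mul_zero]
  simp_rw [h0]
  simp

/-- The initial condition is a limit over t > t₀ and says nothing about the value at `t₀`;
continuity in L²(Ω) identifies the two. -/
theorem IsWeakSolution.ae_eq_initial {N : ℕ} {s p t₀ t₁ : ℝ} (ht : t₀ < t₁) {Ω Ω' : Set (Sp N)}
    {g u : ℝ → Sp N → ℝ} {u₀ : Sp N → ℝ} (hu : IsWeakSolution s p Ω Ω' t₀ t₁ g u₀ u)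
    (hu₀ : MemLp u₀ 2 (volume.restrict Ω)) : u t₀ =ᵐ[volume.restrict Ω] u₀ := by
  obtain ⟨V, hV, hVc⟩ := hu.contL2
  have hmem : ∀ᶠ t in 𝓝[>] t₀, t ∈ Icc t₀ t₁ := by
    filter_upwards [Ioo_mem_nhdsGT ht] with t h using ⟨h.1.le, h.2.le⟩
  have h1 : Tendsto V (𝓝[>] t₀) (𝓝 (V t₀)) :=
    (hVc t₀ (left_mem_Icc.2 ht.le)).mono_left (nhdsWithin_le_iff.2 hmem)
  have h2 : Tendsto V (𝓝[>] t₀) (𝓝 (hu₀.toLp u₀)) := by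
    rw [tendsto_iff_edist_tendsto_0]
    refine hu.initial.congr' ?_
    filter_upwards [hmem] with t h
    rw [Lp.edist_def]
    refine eLpNorm_congr_ae ?_
    filter_upwards [hV t h, hu₀.coeFn_toLp] with x h3 h4
    simp only [Pi.sub_apply, h3, h4]
  have h3 := tendsto_nhds_unique h1 h2
  have h4 := hV t₀ (left_mem_Icc.2 ht.le)
  rw [h3] at h4
  exact h4.symm.trans hu₀.coeFn_toLp

theorem IsWeakSolution.isTestedByConstants {N : ℕ} {s p t₀ t₁ M : ℝ} (hp : 0 < p)
    (ht : t₀ < t₁) (hM : 0 ≤ M) {Ω Ω' : Set (Sp N)} (hΩ : MeasurableSet Ω)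
    {g u : ℝ → Sp N → ℝ} {u₀ : Sp N → ℝ} (hu : IsWeakSolution s p Ω Ω' t₀ t₁ g u₀ u)
    (hu₀ : MemLp u₀ 2 (volume.restrict Ω))
    (hg : ∀ᵐ t ∂(volume.restrict (Icc t₀ t₁)), ∀ᵐ x, |g t x| ≤ M)
    (hu₀M : ∀ᵐ x ∂(volume.restrict Ω), |u₀ x| ≤ M) :
    ∃ U V, IsTestedByConstants s p Ω Ω' t₀ t₁ M u U V := by
  obtain ⟨V, hV, hVc⟩ := hu.contL2
  classical
  have hmeas := hu.lpTail.meas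
  set U₀ := hmeas.mk
  have hU₀ : Measurable U₀ := hmeas.stronglyMeasurable_mk.measurable
  have hU₀ae : ∀ᵐ t ∂(volume.restrict (Icc t₀ t₁)), ∀ᵐ x, u t x = U₀ (t, x) := by
    have := Measure.ae_ae_of_ae_prod hmeas.ae_eq_mk
    simpa [Function.uncurry] using this
  -- Clipping to [-M, M] outside Ω makes the bound hold at every point. For almost every t it alters
  -- U₀ only on a null set, because u = g there and |g| ≤ M.
  refine ⟨fun z => if z.2 ∈ Ω then U₀ z else max (-M) (min M (U₀ z)), V,
    { lpSobolev := hu.lpSobolev.mem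
      finite := hu.lpSobolev.finite
      tail := hu.lpTail.mem
      rep_meas := Measurable.ite (measurable_snd hΩ) hU₀ (by fun_prop)
      rep_bound := fun t y hy => ?_
      rep_ae := ?_
      curve := hV
      cont := hVc
      initial := ?_
      weak := fun T₀ T₁ hT hsub w hw hw2 => hu.weak_const hp hT hsub hw hw2 }⟩
  · simp only [hy, if_false]
    exact abs_le.2 ⟨le_max_left _ _, max_le (by linarith) (min_le_left _ _)⟩
  · filter_upwards [hU₀ae, hg, hu.boundary] with t h1 h2 h3
    filter_upwards [h1, h2, (ae_restrict_iff' hΩ.compl).1 h3.eq_outside] with x h4 h5 h6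
    by_cases hx : x ∈ Ω
    · simp only [hx, if_true, h4]
    · have h7 := abs_le.1 h5
      rw [← h6 hx, h4] at h7
      simp only [hx, if_false]
      rw [min_eq_right h7.2, max_eq_right h7.1, h4]
  · filter_upwards [hu.ae_eq_initial ht hu₀, hu₀M] with x h1 h2
    rwa [h1]

end FracPLap

/-! ### Conclusion. -/

theorem MeasureTheory.MemLp.ae_abs_le_toReal {α : Type*} [MeasurableSpace α] {μ : Measure α}
    {f : α → ℝ} (hf : MemLp f ∞ μ) : ∀ᵐ x ∂μ, |f x| ≤ (eLpNorm f ∞ μ).toReal := by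
  rw [eLpNorm_exponent_top]
  have h : eLpNormEssSup f μ ≠ ∞ := by simpa using hf.2.ne
  filter_upwards [ae_le_eLpNormEssSup (f := f) (μ := μ)] with x hx
  rw [← Real.norm_eq_abs, ← toReal_enorm]
  exact ENNReal.toReal_mono h hx

theorem corollaryA4 {N : ℕ} (hN : 1 ≤ N) {s p t₀ t₁ : ℝ} (hs₀ : 0 < s) (hs₁ : s < 1) (hp : 2 ≤ p)
    (ht : t₀ < t₁)
    {Ω Ω' : Set (Sp N)} (hΩ : IsOpen Ω) (hΩ' : IsOpen Ω') (hΩ'b : Bornology.IsBounded Ω')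
    (hΩΩ' : closure Ω ⊆ Ω')
    {g : ℝ → Sp N → ℝ}
    (hg_sob : MemLpSobolev s p (Icc t₀ t₁) Ω' g)
    (hg_tail : MemLpTail (p - 1) (s * p) (Icc t₀ t₁) g)
    (hg_deriv : HasTimeDerivInDual s p Ω Ω' t₀ t₁ g)
    {g₀ : Sp N → ℝ} (hg₀ : MemLp g₀ 2 (volume.restrict Ω))
    (hg_init : Tendsto (fun t => eLpNorm (g t - g₀) 2 (volume.restrict Ω)) (𝓝[>] t₀) (𝓝 0))
    {u₀ : Sp N → ℝ} (hu₀ : MemLp u₀ 2 (volume.restrict Ω))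
    {u : ℝ → Sp N → ℝ} (hu : IsWeakSolution s p Ω Ω' t₀ t₁ g u₀ u)
    (hg_bdd : MemLp (Function.uncurry g) ∞ (timeSpace (Icc t₀ t₁) univ))
    (hu₀_bdd : MemLp u₀ ∞ (volume.restrict Ω)) :
    eLpNorm (Function.uncurry u) ∞ (timeSpace (Icc t₀ t₁) univ)
      ≤ eLpNorm u₀ ∞ (volume.restrict Ω)
        + eLpNorm (Function.uncurry g) ∞ (timeSpace (Icc t₀ t₁) univ) := by
  have hpq := Real.HolderConjugate.conjExponent (by linarith : 1 < p)
  set Mu := (eLpNorm u₀ ∞ (volume.restrict Ω)).toReal with hMu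
  set Mg := (eLpNorm (Function.uncurry g) ∞ (timeSpace (Icc t₀ t₁) univ)).toReal with hMg
  have hMu0 : 0 ≤ Mu := ENNReal.toReal_nonneg
  have hMg0 : 0 ≤ Mg := ENNReal.toReal_nonneg
  have hM : eLpNorm u₀ ∞ (volume.restrict Ω)
      + eLpNorm (Function.uncurry g) ∞ (timeSpace (Icc t₀ t₁) univ)
        = ENNReal.ofReal (Mu + Mg) := by
    rw [ENNReal.ofReal_add hMu0 hMg0, ENNReal.ofReal_toReal hu₀_bdd.2.ne,
      ENNReal.ofReal_toReal hg_bdd.2.ne]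
  have hgM : ∀ᵐ t ∂(volume.restrict (Icc t₀ t₁)), ∀ᵐ x, |g t x| ≤ Mu + Mg := by
    have h1 := Measure.ae_ae_of_ae_prod hg_bdd.ae_abs_le_toReal
    rw [Measure.restrict_univ] at h1
    filter_upwards [h1] with t h2
    filter_upwards [h2] with x h3
    exact h3.trans (by linarith)
  have hu₀M : ∀ᵐ x ∂(volume.restrict Ω), |u₀ x| ≤ Mu + Mg := by
    filter_upwards [hu₀_bdd.ae_abs_le_toReal] with x h
    exact h.trans (by linarith)
  obtain ⟨U, V, h⟩ := hu.isTestedByConstants (by linarith) ht (add_nonneg hMu0 hMg0)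
    hΩ.measurableSet hu₀ hgM hu₀M
  have hfiber : ∀ᵐ t ∂(volume.restrict (Icc t₀ t₁)), ∀ᵐ x, |u t x| ≤ Mu + Mg := by
    filter_upwards [hgM, hu.boundary, ae_restrict_mem measurableSet_Icc] with t h1 h2 htI
    have h3 := (ae_restrict_iff' hΩ.measurableSet).1
      (h.ae_le (add_nonneg hMu0 hMg0) hs₀ hpq ht.le hΩ hΩ' hΩ'b hΩΩ' htI)
    -- The lower bound is the upper bound for -u, which satisfies the same conditions because J_p is
    -- odd.
    have h4 := (ae_restrict_iff' hΩ.measurableSet).1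
      (h.neg.ae_le (add_nonneg hMu0 hMg0) hs₀ hpq ht.le hΩ hΩ' hΩ'b hΩΩ' htI)
    filter_upwards [h1, (ae_restrict_iff' hΩ.measurableSet.compl).1 h2.eq_outside, h3, h4]
      with x h5 h6 h7 h8
    by_cases hx : x ∈ Ω
    · have := h8 hx
      simp only [Pi.neg_apply] at this
      exact abs_le.2 ⟨by linarith, h7 hx⟩
    · rwa [h6 hx]
  have hmeas := hu.lpTail.meas
  have hprod : ∀ᵐ z ∂(timeSpace (Icc t₀ t₁) (univ : Set (Sp N))),
      ‖Function.uncurry u z‖ ≤ Mu + Mg := by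
    -- Passing from almost every slice to almost every point of the product requires a measurable
    -- set, hence the measurable representative.
    have h1 : ∀ᵐ z ∂(timeSpace (Icc t₀ t₁) (univ : Set (Sp N))), ‖hmeas.mk _ z‖ ≤ Mu + Mg := by
      rw [Measure.ae_prod_iff_ae_ae
        (measurableSet_le hmeas.stronglyMeasurable_mk.measurable.norm measurable_const)]
      filter_upwards [hfiber, Measure.ae_ae_of_ae_prod hmeas.ae_eq_mk] with t h2 h3
      filter_upwards [ae_restrict_of_ae h2, h3] with x h4 h5
      rw [← h5]
      exact h4
    filter_upwards [h1, hmeas.ae_eq_mk] with z h2 h3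
    rwa [h3]
  rw [hM, eLpNorm_exponent_top]
  exact eLpNormEssSup_le_of_ae_bound hprod
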